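/- **Setting.** Fix an order of smoothness $n\in\{1,2,\dots,\infty,\omega\}$. Let $D\subset\mathbb R^3$ be a domain (non-empty, open, connected) of parameters $k=(k^1,k^2,k^3)$, and consider maps $x=x(k)\in\mathbb R^3$ on $D$ (they describe stationary ideal incompressible MHD flows with constant total pressure; for fixed $k^3$ the image is a Maxwellian surface). Functions below are of class $C^n$ on the ranges of their arguments (of class $C^{n+1}$ for $\eta$ in (2) and for $\alpha,\beta,\gamma$ in (6); no separate smoothness is required of $\nu$ in (4) and of $\alpha$ in (F), which are expressed through derivatives of $\tau$). A lower index $i$ means $\partial/\partial k^i$, a prime means $d/dk^3$, upper indices are Cartesian components, $e^1,e^2,e^3$ is the standard basis, and $\tau,\tau^i,u,v,\varphi$ (unless another argument is shown) are functions of $(k^2,k^3)$. Write $\dfrac{\partial(f,g)}{\partial(k^2,k^3)}=f_2g_3-g_2f_3$. **Canonical solutions.** 1. $x=k^1e^1+\tau$ with $\dfrac{\partial(\tau^2,\tau^3)}{\partial(k^2,k^3)}=1$. 2. (cylindrical form) $x=k^1\eta(k^3)+u\,\eta'(k^3)+v\,\eta(k^3)+\delta(k^3)$ with $\tfrac12\,\eta\cdot(\eta'\times\eta'')\,u^2+\eta\cdot(\eta'\times\delta')\,u=k^2$.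 3. $x=\bigl(k^1+F(\tau^3)\bigr)e^1+\bigl(g(k^1)+\tau^2\bigr)e^2+\tau^3e^3$ with $\dfrac{\partial(\tau^2,\tau^3)}{\partial(k^2,k^3)}=1$. 4. $x=\bigl(f(\lambda)+\tau^1\bigr)e^1+\bigl(g(\lambda)+\tau^2\bigr)e^2+\tau^3e^3$, where $\lambda=\lambda(k^1,k^3)$ takes values in an open interval on which $f$ and $g$ are defined, $g(\lambda)=f(\lambda)\,\nu(k^3)+k^1$, $\dfrac{\partial(\tau^1,\tau^3)}{\partial(k^2,k^3)}=-1$ and $\dfrac{\partial(\tau^2,\tau^3)}{\partial(k^2,k^3)}=-\nu(k^3)$. 5. $x=\bigl(u^1(k^1)+\tau^1\bigr)e^1+\bigl(u^2(k^1)+\tau^2\bigr)e^2+k^1e^3$ with $\dfrac{\partial(\tau^1,\tau^2)}{\partial(k^2,k^3)}=1$. 6. $x=\bigl(u^1(\lambda)+\tau^1\bigr)e^1+\bigl(u^2(\lambda)+\tau^2\bigr)e^2+\bigl(S(\lambda)+\alpha\tau^1+\beta\tau^2+\gamma\bigr)e^3$, where $u^1,u^2,S$ are linearly independent functions on an open interval,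 $\alpha,\beta,\gamma$ are functions of $k^3$ with $(\alpha')^2+(\beta')^2\ne0$, $\lambda=\lambda(k^1,k^3)$ satisfies $\alpha u^1(\lambda)+\beta u^2(\lambda)+k^1=S(\lambda)$, $$\tau^1=\beta'\varphi-\frac{\alpha'\gamma'}{(\alpha')^2+(\beta')^2},\qquad \tau^2=-\alpha'\varphi-\frac{\beta'\gamma'}{(\alpha')^2+(\beta')^2},$$ and $\varphi(k^2,k^3)$ satisfies $$\frac{\alpha'\beta''-\beta'\alpha''}{2}\,\varphi^2-\Bigl(\gamma''-\frac{\gamma'(\alpha'\alpha''+\beta'\beta'')}{(\alpha')^2+(\beta')^2}\Bigr)\varphi=k^2 .$$ **The family (F) of solutions whose Maxwellian surfaces have a common directing curve.** These are the maps $$x=\sigma\bigl(\lambda(k^1,k^3)\bigr)+\tau(k^2,k^3),\qquad \sigma\bigl(\lambda(k^1,k^3)\bigr)\cdot\alpha=k^1,\qquad \tau_2\times\tau_3=\alpha,$$ where $\sigma$ is a vector function on an open interval that contains the values of $\lambda$, and $\alpha=\alpha(k^3)$, except that a component of $\alpha$ may depend on $(k^2,k^3)$ if the same component of $\sigma$ vanishes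 identically. **Equivalence transformations** are the changes of parameters $\tilde k=(\varphi(k^3)k^1,\;k^2/\varphi(k^3),\;k^3)$ with $\varphi\neq0$, and $\tilde k=(k^1+\psi(k^3),\;k^2+\chi(k^3),\;k^3)$, with $\varphi,\psi,\chi$ of class $C^n$. **Theorem.** Every canonical solution 1–6 is a member of the family (F) or has the cylindrical form 2. Consequently every map that is obtained from a canonical solution by equivalence transformations is obtained by equivalence transformations from a member of (F) or from a solution of the form 2. -/

import Mathlib

open scoped Matrix

noncomputable section

namespace ConstPressureMHD

/-- Vectors of `ℝ³` in Cartesian components; the components `1, 2, 3` are the indices `0, 1, 2`. -/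
abbrev Vec3 : Type := Fin 3 → ℝ

/-- A vector function `x = x(k¹, k², k³)` on a domain (a non-empty connected open set) of the
parameters `k = (k¹, k², k³)`. Values outside the domain are irrelevant. -/
structure Flow where
  dom : Set (ℝ × ℝ × ℝ)
  isOpen : IsOpen dom
  isConnected : IsConnected dom
  pos : ℝ × ℝ × ℝ → Vec3

namespace Flow

/-- Values taken by `k¹`. -/
def dom1 (X : Flow) : Set ℝ := (fun k : ℝ × ℝ × ℝ => k.1) '' X.dom

/-- Values taken by `k³`. -/
def dom3 (X : Flow) : Set ℝ := (fun k : ℝ × ℝ × ℝ => k.2.2) '' X.dom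

/-- Values taken by `(k¹, k³)`. -/
def dom13 (X : Flow) : Set (ℝ × ℝ) := (fun k : ℝ × ℝ × ℝ => (k.1, k.2.2)) '' X.dom

/-- Values taken by `(k², k³)`. -/
def dom23 (X : Flow) : Set (ℝ × ℝ) := (fun k : ℝ × ℝ × ℝ => k.2) '' X.dom

end Flow

/-- Partial derivative in the first of two variables. -/
def dFst {E : Type*} [NormedAddCommGroup E] [NormedSpace ℝ E] (f : ℝ × ℝ → E) (p : ℝ × ℝ) : E :=
  deriv (fun t => f (t, p.2)) p.1

/-- Partial derivative in the second of two variables. -/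
def dSnd {E : Type*} [NormedAddCommGroup E] [NormedSpace ℝ E] (f : ℝ × ℝ → E) (p : ℝ × ℝ) : E :=
  deriv (fun t => f (p.1, t)) p.2

/-- For functions of `(k², k³)`: the determinant with rows `(f₂, g₂)` and `(f₃, g₃)`. -/
def jac (f g : ℝ × ℝ → ℝ) (p : ℝ × ℝ) : ℝ :=
  dFst f p * dSnd g p - dFst g p * dSnd f p

/-! The canonical solutions. Throughout, `n` is the order of smoothness. -/

/-- Straight generatrix of constant direction:
`x = k¹ e¹ + τ(k², k³)`, the Jacobian of `(τ², τ³)` being `1`. -/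
def StraightConst (n : WithTop ℕ∞) (X : Flow) : Prop :=
  ∃ τ : ℝ × ℝ → Vec3,
    ContDiffOn ℝ n τ X.dom23 ∧
    (∀ p ∈ X.dom23, jac (fun q => τ q 1) (fun q => τ q 2) p = 1) ∧
    ∀ k ∈ X.dom, X.pos k = ![k.1, 0, 0] + τ k.2

/-- The cylindrical form: `x = k¹ η(k³) + u(k², k³) η'(k³) + v(k², k³) η(k³) + δ(k³)` with
`(η · (η' × η'') / 2) u² + (η · (η' × δ')) u = k²`. -/
def Cylindrical (n : WithTop ℕ∞) (X : Flow) : Prop :=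
  ∃ (η δ : ℝ → Vec3) (u v : ℝ × ℝ → ℝ),
    ContDiffOn ℝ (n + 1) η X.dom3 ∧ ContDiffOn ℝ n δ X.dom3 ∧
    ContDiffOn ℝ n u X.dom23 ∧ ContDiffOn ℝ n v X.dom23 ∧
    (∀ p ∈ X.dom23,
      (η p.2 ⬝ᵥ (deriv η p.2 ⨯₃ deriv (deriv η) p.2)) / 2 * u p ^ 2
        + (η p.2 ⬝ᵥ (deriv η p.2 ⨯₃ deriv δ p.2)) * u p = p.1) ∧
    ∀ k ∈ X.dom, X.pos k =
      k.1 • η k.2.2 + u k.2 • deriv η k.2.2 + v k.2 • η k.2.2 + δ k.2.2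

/-- Planar generatrix, first form:
`x = (k¹ + F(τ³)) e¹ + (g(k¹) + τ²) e² + τ³ e³`, the Jacobian of `(τ², τ³)` being `1`. -/
def PlanarFirst (n : WithTop ℕ∞) (X : Flow) : Prop :=
  ∃ (K : Set ℝ) (F g : ℝ → ℝ) (τ2 τ3 : ℝ × ℝ → ℝ),
    IsOpen K ∧ Set.MapsTo τ3 X.dom23 K ∧ ContDiffOn ℝ n F K ∧ ContDiffOn ℝ n g X.dom1 ∧
    ContDiffOn ℝ n τ2 X.dom23 ∧ ContDiffOn ℝ n τ3 X.dom23 ∧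
    (∀ p ∈ X.dom23, jac τ2 τ3 p = 1) ∧
    ∀ k ∈ X.dom, X.pos k = ![k.1 + F (τ3 k.2), g k.1 + τ2 k.2, τ3 k.2]

/-- Planar generatrix, second form: `x = (f(λ) + τ¹) e¹ + (g(λ) + τ²) e² + τ³ e³`, where
`λ(k¹, k³)` satisfies `g(λ) = f(λ) ν(k³) + k¹` and the Jacobians of `(τ¹, τ³)` and `(τ², τ³)` are
`-1` and `-ν(k³)`. (The smoothness of `ν` follows from that of `τ`.) -/
def PlanarSecond (n : WithTop ℕ∞) (X : Flow) : Prop :=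
  ∃ (J : Set ℝ) (f g ν : ℝ → ℝ) (lam : ℝ × ℝ → ℝ) (τ1 τ2 τ3 : ℝ × ℝ → ℝ),
    IsOpen J ∧ IsConnected J ∧ Set.MapsTo lam X.dom13 J ∧
    ContDiffOn ℝ n f J ∧ ContDiffOn ℝ n g J ∧ ContDiffOn ℝ n lam X.dom13 ∧
    ContDiffOn ℝ n τ1 X.dom23 ∧ ContDiffOn ℝ n τ2 X.dom23 ∧ ContDiffOn ℝ n τ3 X.dom23 ∧
    (∀ p ∈ X.dom13, g (lam p) = f (lam p) * ν p.2 + p.1) ∧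
    (∀ p ∈ X.dom23, jac τ1 τ3 p = -1 ∧ jac τ2 τ3 p = -ν p.2) ∧
    ∀ k ∈ X.dom, X.pos k =
      ![f (lam (k.1, k.2.2)) + τ1 k.2, g (lam (k.1, k.2.2)) + τ2 k.2, τ3 k.2]

/-- Planar generatrix, third form:
`x = (u¹(k¹) + τ¹) e¹ + (u²(k¹) + τ²) e² + k¹ e³`, the Jacobian of `(τ¹, τ²)` being `1`. -/
def PlanarThird (n : WithTop ℕ∞) (X : Flow) : Prop :=
  ∃ (u1 u2 : ℝ → ℝ) (τ1 τ2 : ℝ × ℝ → ℝ),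
    ContDiffOn ℝ n u1 X.dom1 ∧ ContDiffOn ℝ n u2 X.dom1 ∧
    ContDiffOn ℝ n τ1 X.dom23 ∧ ContDiffOn ℝ n τ2 X.dom23 ∧
    (∀ p ∈ X.dom23, jac τ1 τ2 p = 1) ∧
    ∀ k ∈ X.dom, X.pos k = ![u1 k.1 + τ1 k.2, u2 k.1 + τ2 k.2, k.1]

/-- Spatial generatrix:
`x = (u¹(λ) + τ¹) e¹ + (u²(λ) + τ²) e² + (S(λ) + α τ¹ + β τ² + γ) e³`, where
`α, β, γ` depend on `k³`, the functions `u¹, u², S` are linearly independent, `λ(k¹, k³)` satisfies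
`α u¹(λ) + β u²(λ) + k¹ = S(λ)`, and `τ¹, τ²` are expressed through a function `φ(k², k³)` that
satisfies a quadratic equation. -/
def Spatial (n : WithTop ℕ∞) (X : Flow) : Prop :=
  ∃ (J : Set ℝ) (u1 u2 S : ℝ → ℝ) (lam : ℝ × ℝ → ℝ) (α β γ : ℝ → ℝ) (φ τ1 τ2 : ℝ × ℝ → ℝ),
    IsOpen J ∧ IsConnected J ∧ Set.MapsTo lam X.dom13 J ∧
    ContDiffOn ℝ n u1 J ∧ ContDiffOn ℝ n u2 J ∧ ContDiffOn ℝ n S J ∧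
    LinearIndependent ℝ ![J.domRestrict u1, J.domRestrict u2, J.domRestrict S] ∧
    ContDiffOn ℝ n lam X.dom13 ∧
    ContDiffOn ℝ (n + 1) α X.dom3 ∧ ContDiffOn ℝ (n + 1) β X.dom3 ∧
    ContDiffOn ℝ (n + 1) γ X.dom3 ∧ ContDiffOn ℝ n φ X.dom23 ∧
    (∀ t ∈ X.dom3, deriv α t ^ 2 + deriv β t ^ 2 ≠ 0) ∧
    (∀ p ∈ X.dom13, α p.2 * u1 (lam p) + β p.2 * u2 (lam p) + p.1 = S (lam p)) ∧
    (∀ p ∈ X.dom23,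
      τ1 p = deriv β p.2 * φ p
        - deriv α p.2 * deriv γ p.2 / (deriv α p.2 ^ 2 + deriv β p.2 ^ 2) ∧
      τ2 p = -deriv α p.2 * φ p
        - deriv β p.2 * deriv γ p.2 / (deriv α p.2 ^ 2 + deriv β p.2 ^ 2) ∧
      (deriv α p.2 * deriv (deriv β) p.2 - deriv β p.2 * deriv (deriv α) p.2) / 2 * φ p ^ 2
        - (deriv (deriv γ) p.2
            - deriv γ p.2 * (deriv α p.2 * deriv (deriv α) p.2
                + deriv β p.2 * deriv (deriv β) p.2)
              / (deriv α p.2 ^ 2 + deriv β p.2 ^ 2)) * φ p = p.1) ∧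
    ∀ k ∈ X.dom, X.pos k =
      ![u1 (lam (k.1, k.2.2)) + τ1 k.2,
        u2 (lam (k.1, k.2.2)) + τ2 k.2,
        S (lam (k.1, k.2.2)) + α k.2.2 * τ1 k.2 + β k.2.2 * τ2 k.2 + γ k.2.2]

/-- The list of canonical solutions. -/
def Canonical (n : WithTop ℕ∞) (X : Flow) : Prop :=
  StraightConst n X ∨ Cylindrical n X ∨ PlanarFirst n X ∨ PlanarSecond n X ∨ PlanarThird n X ∨
    Spatial n X

/-- Maxwellian surfaces with a common directing curve `σ`:
`x = σ(λ(k¹, k³)) + τ(k², k³)`, `σ(λ(k¹, k³)) · α = k¹`, `τ₂ × τ₃ = α`. A component of `α` is a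
function of `k³` alone, except that it may depend on `(k², k³)` if the same component of
`σ` is identically zero. (The smoothness of `α` follows from that of `τ`.) -/
def CommonDirectrix (n : WithTop ℕ∞) (X : Flow) : Prop :=
  ∃ (J : Set ℝ) (σ : ℝ → Vec3) (lam : ℝ × ℝ → ℝ) (τ α : ℝ × ℝ → Vec3),
    IsOpen J ∧ IsConnected J ∧ Set.MapsTo lam X.dom13 J ∧
    ContDiffOn ℝ n σ J ∧ ContDiffOn ℝ n lam X.dom13 ∧ ContDiffOn ℝ n τ X.dom23 ∧
    (∀ i : Fin 3, (∀ s ∈ J, σ s i = 0) ∨ ∃ a : ℝ → ℝ, ∀ p ∈ X.dom23, α p i = a p.2) ∧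
    (∀ k ∈ X.dom, σ (lam (k.1, k.2.2)) ⬝ᵥ α k.2 = k.1) ∧
    (∀ p ∈ X.dom23, dFst τ p ⨯₃ dSnd τ p = α p) ∧
    ∀ k ∈ X.dom, X.pos k = σ (lam (k.1, k.2.2)) + τ k.2

/-! Equivalence transformations. -/

/-- `Y` is `X` in the parameters `φ(k³) k¹, k² / φ(k³), k³`. -/
def Rescaled (n : WithTop ℕ∞) (X Y : Flow) : Prop :=
  ∃ φ : ℝ → ℝ, ContDiffOn ℝ n φ X.dom3 ∧ (∀ t ∈ X.dom3, φ t ≠ 0) ∧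
    Y.dom = (fun k : ℝ × ℝ × ℝ => (φ k.2.2 * k.1, k.2.1 / φ k.2.2, k.2.2)) '' X.dom ∧
    ∀ k ∈ X.dom, Y.pos (φ k.2.2 * k.1, k.2.1 / φ k.2.2, k.2.2) = X.pos k

/-- `Y` is `X` in the parameters `k¹ + ψ(k³), k² + χ(k³), k³`. -/
def Shifted (n : WithTop ℕ∞) (X Y : Flow) : Prop :=
  ∃ ψ χ : ℝ → ℝ, ContDiffOn ℝ n ψ X.dom3 ∧ ContDiffOn ℝ n χ X.dom3 ∧
    Y.dom = (fun k : ℝ × ℝ × ℝ => (k.1 + ψ k.2.2, k.2.1 + χ k.2.2, k.2.2)) '' X.dom ∧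
    ∀ k ∈ X.dom, Y.pos (k.1 + ψ k.2.2, k.2.1 + χ k.2.2, k.2.2) = X.pos k

/-- Equivalence generated by the two kinds of transformations. -/
def Equivalent (n : WithTop ℕ∞) : Flow → Flow → Prop :=
  Relation.EqvGen (fun X Y => Rescaled n X Y ∨ Shifted n X Y)

end ConstPressureMHD

end

/-!
For `x = σ(λ(k¹, k³)) + τ(k², k³)` the components of `τ₂ × τ₃` are the Jacobians of pairs of
components of `τ`, so the solution belongs to the family (F) as soon as the Jacobians that are
paired with a non-zero component of `σ` depend on `k³` alone. In the solutions 1, 3 and 4 the curve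
`σ` lies in a coordinate line or plane, and the relevant Jacobians are either prescribed or vanish
because their two arguments are functionally dependent.

In the solutions 5 and 6 the vector `τ` lies on the planes `x³ = α x¹ + β x² + γ`, which depend on
`k³`, and also satisfies the differentiated equation `α' x¹ + β' x² + γ' = 0` (in 5 all of
`α, β, γ` vanish). Hence `dτ³ = α dτ¹ + β dτ²` and `τ₂ × τ₃` is the Jacobian of `(τ¹, τ²)` times
`(-α, -β, 1)`. In 6 the quadratic equation for `φ`, differentiated in `k²`, says that this Jacobian
is `1`.
-/

namespace ConstPressureMHD

namespace Flow

theorem isOpen_dom1 (X : Flow) : IsOpen X.dom1 := isOpenMap_fst _ X.isOpen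

theorem isConnected_dom1 (X : Flow) : IsConnected X.dom1 :=
  X.isConnected.image _ continuous_fst.continuousOn

theorem isOpen_dom3 (X : Flow) : IsOpen X.dom3 :=
  (isOpenMap_snd.comp isOpenMap_snd) _ X.isOpen

theorem isOpen_dom23 (X : Flow) : IsOpen X.dom23 := isOpenMap_snd _ X.isOpen

variable {X : Flow}

theorem mem_dom13 {k : ℝ × ℝ × ℝ} (hk : k ∈ X.dom) : (k.1, k.2.2) ∈ X.dom13 := ⟨k, hk, rfl⟩

theorem mem_dom23 {k : ℝ × ℝ × ℝ} (hk : k ∈ X.dom) : k.2 ∈ X.dom23 := ⟨k, hk, rfl⟩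

theorem mapsTo_fst_dom13 : Set.MapsTo Prod.fst X.dom13 X.dom1 := by
  rintro _ ⟨k, hk, rfl⟩
  exact ⟨k, hk, rfl⟩

theorem mapsTo_snd_dom23 : Set.MapsTo Prod.snd X.dom23 X.dom3 := by
  rintro _ ⟨k, hk, rfl⟩
  exact ⟨k, hk, rfl⟩

end Flow

section Smoothness

variable {E F : Type*} [NormedAddCommGroup E] [NormedSpace ℝ E]
  [NormedAddCommGroup F] [NormedSpace ℝ F] {n : WithTop ℕ∞}

theorem contDiffOn_vec3 {s : Set E} {f g h : E → ℝ} (hf : ContDiffOn ℝ n f s)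
    (hg : ContDiffOn ℝ n g s) (hh : ContDiffOn ℝ n h s) :
    ContDiffOn ℝ n (fun x => ![f x, g x, h x]) s :=
  contDiffOn_pi.2 <| Fin.forall_fin_succ.2 ⟨hf, Fin.forall_fin_two.2 ⟨hg, hh⟩⟩

theorem differentiableAt_of_contDiffOn {s : Set E} {f : E → F} {x : E} (hn : n ≠ 0)
    (hf : ContDiffOn ℝ n f s) (hs : IsOpen s) (hx : x ∈ s) : DifferentiableAt ℝ f x :=
  (hf.contDiffAt (hs.mem_nhds hx)).differentiableAt hn

theorem contDiffOn_comp_snd {X : Flow} {f : ℝ → F} (hf : ContDiffOn ℝ n f X.dom3) :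
    ContDiffOn ℝ n (fun p : ℝ × ℝ => f p.2) X.dom23 :=
  hf.comp contDiff_snd.contDiffOn Flow.mapsTo_snd_dom23

end Smoothness

section Jacobian

variable {E : Type*} [NormedAddCommGroup E] [NormedSpace ℝ E] {p : ℝ × ℝ}

theorem hasDerivAt_fst_slice {f : ℝ × ℝ → E} {f' : ℝ × ℝ →L[ℝ] E} (hf : HasFDerivAt f f' p) :
    HasDerivAt (fun t => f (t, p.2)) (f' (1, 0)) p.1 :=
  hf.comp_hasDerivAt p.1 ((hasDerivAt_id p.1).prodMk (hasDerivAt_const p.1 p.2))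

theorem hasDerivAt_snd_slice {f : ℝ × ℝ → E} {f' : ℝ × ℝ →L[ℝ] E} (hf : HasFDerivAt f f' p) :
    HasDerivAt (fun t => f (p.1, t)) (f' (0, 1)) p.2 :=
  hf.comp_hasDerivAt p.2 ((hasDerivAt_const p.2 p.1).prodMk (hasDerivAt_id p.2))

theorem hasFDerivAt_comp_snd {f : ℝ → ℝ} {f' : ℝ} (hf : HasDerivAt f f' p.2) :
    HasFDerivAt (fun q : ℝ × ℝ => f q.2) (f' • ContinuousLinearMap.snd ℝ ℝ ℝ) p :=
  hf.comp_hasFDerivAt p hasFDerivAt_snd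

theorem jac_eq_of_hasFDerivAt {f g : ℝ × ℝ → ℝ} {f' g' : ℝ × ℝ →L[ℝ] ℝ}
    (hf : HasFDerivAt f f' p) (hg : HasFDerivAt g g' p) :
    jac f g p = f' (1, 0) * g' (0, 1) - g' (1, 0) * f' (0, 1) := by
  simp only [jac, dFst, dSnd, (hasDerivAt_fst_slice hf).deriv, (hasDerivAt_snd_slice hf).deriv,
    (hasDerivAt_fst_slice hg).deriv, (hasDerivAt_snd_slice hg).deriv]

theorem jac_swap (f g : ℝ × ℝ → ℝ) (p : ℝ × ℝ) : jac g f p = -jac f g p := by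
  unfold jac
  ring

theorem jac_comp_self {F : ℝ → ℝ} {f : ℝ × ℝ → ℝ} (hF : DifferentiableAt ℝ F (f p))
    (hf : DifferentiableAt ℝ f p) : jac f (fun q => F (f q)) p = 0 := by
  have dF : HasFDerivAt (fun q => F (f q)) (deriv F (f p) • fderiv ℝ f p) p :=
    hF.hasDerivAt.comp_hasFDerivAt p hf.hasFDerivAt
  rw [jac_eq_of_hasFDerivAt hf.hasFDerivAt dF]
  simp only [smul_apply, smul_eq_mul]
  ring

theorem crossProduct_partials_eq_jac {τ : ℝ × ℝ → Vec3} (hτ : DifferentiableAt ℝ τ p) :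
    dFst τ p ⨯₃ dSnd τ p =
      ![jac (fun q => τ q 1) (fun q => τ q 2) p, jac (fun q => τ q 2) (fun q => τ q 0) p,
        jac (fun q => τ q 0) (fun q => τ q 1) p] := by
  have hFst (i : Fin 3) : dFst τ p i = dFst (fun q => τ q i) p :=
    (hasDerivAt_pi.1 (hasDerivAt_fst_slice hτ.hasFDerivAt).differentiableAt.hasDerivAt i).deriv.symm
  have hSnd (i : Fin 3) : dSnd τ p i = dSnd (fun q => τ q i) p :=
    (hasDerivAt_pi.1 (hasDerivAt_snd_slice hτ.hasFDerivAt).differentiableAt.hasDerivAt i).deriv.symm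
  simp only [cross_apply, hFst, hSnd, jac]

end Jacobian

section Envelope

variable {α β γ : ℝ → ℝ} {τ1 τ2 : ℝ × ℝ → ℝ} {α' β' γ' : ℝ} {p : ℝ × ℝ}

theorem hasFDerivAt_envelope {τ1' τ2' : ℝ × ℝ →L[ℝ] ℝ} (hα : HasDerivAt α α' p.2)
    (hβ : HasDerivAt β β' p.2) (hγ : HasDerivAt γ γ' p.2) (hτ1 : HasFDerivAt τ1 τ1' p)
    (hτ2 : HasFDerivAt τ2 τ2' p) (henv : α' * τ1 p + β' * τ2 p + γ' = 0) :
    HasFDerivAt (fun q => α q.2 * τ1 q + β q.2 * τ2 q + γ q.2)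
      (α p.2 • τ1' + β p.2 • τ2') p := by
  refine ((((hasFDerivAt_comp_snd hα).mul hτ1).add ((hasFDerivAt_comp_snd hβ).mul hτ2)).add
    (hasFDerivAt_comp_snd hγ)).congr_fderiv ?_
  refine ContinuousLinearMap.ext fun v => ?_
  simp only [add_apply, smul_apply, smul_eq_mul, ContinuousLinearMap.coe_snd']
  -- The terms that differentiate `α, β, γ` add up to `(α' τ¹ + β' τ² + γ') dk³ = 0`.
  linear_combination v.2 * henv

theorem crossProduct_partials_envelope (hα : HasDerivAt α α' p.2) (hβ : HasDerivAt β β' p.2)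
    (hγ : HasDerivAt γ γ' p.2) (hτ1 : DifferentiableAt ℝ τ1 p) (hτ2 : DifferentiableAt ℝ τ2 p)
    (henv : α' * τ1 p + β' * τ2 p + γ' = 0) :
    let τ3 : ℝ × ℝ → ℝ := fun q => α q.2 * τ1 q + β q.2 * τ2 q + γ q.2
    dFst (fun q => ![τ1 q, τ2 q, τ3 q]) p ⨯₃ dSnd (fun q => ![τ1 q, τ2 q, τ3 q]) p =
      jac τ1 τ2 p • ![-α p.2, -β p.2, 1] := by
  intro τ3
  have dτ1 := hτ1.hasFDerivAt
  have dτ2 := hτ2.hasFDerivAt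
  have dτ3 : HasFDerivAt τ3 _ p := hasFDerivAt_envelope hα hβ hγ dτ1 dτ2 henv
  have hτ : DifferentiableAt ℝ (fun q => ![τ1 q, τ2 q, τ3 q]) p := differentiableAt_pi.2 <|
    Fin.forall_fin_succ.2 ⟨hτ1, Fin.forall_fin_two.2 ⟨hτ2, dτ3.differentiableAt⟩⟩
  have jac23 : jac τ2 τ3 p = jac τ1 τ2 p * -α p.2 := by
    rw [jac_eq_of_hasFDerivAt dτ2 dτ3, jac_eq_of_hasFDerivAt dτ1 dτ2]
    simp only [add_apply, smul_apply, smul_eq_mul]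
    ring
  have jac31 : jac τ3 τ1 p = jac τ1 τ2 p * -β p.2 := by
    rw [jac_eq_of_hasFDerivAt dτ3 dτ1, jac_eq_of_hasFDerivAt dτ1 dτ2]
    simp only [add_apply, smul_apply, smul_eq_mul]
    ring
  simp [crossProduct_partials_eq_jac hτ, jac23, jac31]

end Envelope

section Characteristic

theorem mul_deriv_eq_one_of_quadratic {A B f' t : ℝ} {f : ℝ → ℝ} (hf : HasDerivAt f f' t)
    (h : ∀ᶠ s in nhds t, A / 2 * f s ^ 2 - B * f s = s) : f' * (A * f t - B) = 1 := by
  have hd := ((hf.pow 2).const_mul (A / 2)).sub (hf.const_mul B)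
  have := hd.unique ((hasDerivAt_id t).congr_of_eventuallyEq h)
  simp only [Nat.cast_ofNat, Nat.add_one_sub_one, pow_one] at this
  linear_combination this

variable {a b c m l : ℝ → ℝ} {φ τ1 τ2 : ℝ × ℝ → ℝ} {a' b' m' l' : ℝ} {p : ℝ × ℝ}

theorem jac_of_characteristic {φ' : ℝ × ℝ →L[ℝ] ℝ} (ha : HasDerivAt a a' p.2)
    (hb : HasDerivAt b b' p.2) (hm : HasDerivAt m m' p.2) (hl : HasDerivAt l l' p.2)
    (hφ : HasFDerivAt φ φ' p) (hτ1 : τ1 =ᶠ[nhds p] fun q => b q.2 * φ q - m q.2)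
    (hτ2 : τ2 =ᶠ[nhds p] fun q => -a q.2 * φ q - l q.2) :
    jac τ1 τ2 p = φ' (1, 0) *
      ((a p.2 * b' - b p.2 * a') * φ p - (a p.2 * m' + b p.2 * l')) := by
  have dτ1 := (((hasFDerivAt_comp_snd hb).mul hφ).sub
    (hasFDerivAt_comp_snd hm)).congr_of_eventuallyEq hτ1
  have dτ2 := (((hasFDerivAt_comp_snd ha).neg.mul hφ).sub
    (hasFDerivAt_comp_snd hl)).congr_of_eventuallyEq hτ2
  rw [jac_eq_of_hasFDerivAt dτ1 dτ2]
  simp only [sub_apply, add_apply, smul_apply, smul_eq_mul, ContinuousLinearMap.coe_snd',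
    Pi.neg_apply, neg_apply]
  ring

theorem jac_eq_one_of_quadratic {T : Set ℝ} {D : Set (ℝ × ℝ)} (hT : IsOpen T) (hD : IsOpen D)
    (hDT : Set.MapsTo Prod.snd D T) (ha : DifferentiableOn ℝ a T) (hb : DifferentiableOn ℝ b T)
    (hc : DifferentiableOn ℝ c T) (hm : DifferentiableOn ℝ m T) (hl : DifferentiableOn ℝ l T)
    (hφ : DifferentiableOn ℝ φ D) (hτ1 : ∀ q ∈ D, τ1 q = b q.2 * φ q - m q.2)
    (hτ2 : ∀ q ∈ D, τ2 q = -a q.2 * φ q - l q.2)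
    (hfoot : ∀ t ∈ T, a t * m t + b t * l t = c t)
    (hquad : ∀ q ∈ D, (a q.2 * deriv b q.2 - b q.2 * deriv a q.2) / 2 * φ q ^ 2 -
      (deriv c q.2 - (deriv a q.2 * m q.2 + deriv b q.2 * l q.2)) * φ q = q.1)
    (hp : p ∈ D) : jac τ1 τ2 p = 1 := by
  have hasDerivAt_coeff {f : ℝ → ℝ} (hf : DifferentiableOn ℝ f T) : HasDerivAt f _ p.2 :=
    (hf.differentiableAt (hT.mem_nhds (hDT hp))).hasDerivAt
  have da := hasDerivAt_coeff ha
  have db := hasDerivAt_coeff hb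
  have dm := hasDerivAt_coeff hm
  have dl := hasDerivAt_coeff hl
  have dφ := (hφ.differentiableAt (hD.mem_nhds hp)).hasFDerivAt
  have hnhds := hD.eventually_mem hp
  have hslice : ∀ᶠ s in nhds p.1, (s, p.2) ∈ D :=
    (Continuous.prodMk_left p.2).continuousAt.eventually hnhds
  have hfoot_deriv : deriv a p.2 * m p.2 + a p.2 * deriv m p.2 +
      (deriv b p.2 * l p.2 + b p.2 * deriv l p.2) = deriv c p.2 :=
    ((da.mul dm).add (db.mul dl)).unique <|
      (hasDerivAt_coeff hc).congr_of_eventuallyEq ((hT.eventually_mem (hDT hp)).mono hfoot)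
  have hquad_deriv : fderiv ℝ φ p (1, 0) *
      ((a p.2 * deriv b p.2 - b p.2 * deriv a p.2) * φ p -
        (deriv c p.2 - (deriv a p.2 * m p.2 + deriv b p.2 * l p.2))) = 1 :=
    mul_deriv_eq_one_of_quadratic (hasDerivAt_fst_slice dφ)
      (hslice.mono fun s hs => hquad (s, p.2) hs)
  rw [jac_of_characteristic da db dm dl dφ (hnhds.mono hτ1) (hnhds.mono hτ2)]
  linear_combination hquad_deriv - fderiv ℝ φ p (1, 0) * hfoot_deriv

end Characteristic

variable {n : WithTop ℕ∞} {X : Flow} {J : Set ℝ} {lam : ℝ × ℝ → ℝ}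

theorem StraightConst.commonDirectrix (hn : n ≠ 0) (h : StraightConst n X) :
    CommonDirectrix n X := by
  obtain ⟨τ, hτ, hjac, hpos⟩ := h
  have hcross (p) (hp : p ∈ X.dom23) := crossProduct_partials_eq_jac
    (differentiableAt_of_contDiffOn hn hτ X.isOpen_dom23 hp)
  refine ⟨Set.univ, fun s => ![s, 0, 0], Prod.fst, τ, fun p => dFst τ p ⨯₃ dSnd τ p,
    isOpen_univ, isConnected_univ, Set.mapsTo_univ _ _,
    contDiffOn_vec3 contDiffOn_id contDiffOn_const contDiffOn_const, contDiff_fst.contDiffOn, hτ,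
    fun i => ?_, fun k hk => ?_, fun _ _ => rfl, hpos⟩
  · fin_cases i
    · exact .inr ⟨fun _ => 1, fun p hp => by simp [hcross p hp, hjac p hp]⟩
    · exact .inl fun s _ => by simp
    · exact .inl fun s _ => by simp
  · have hp := Flow.mem_dom23 hk
    simp [hcross _ hp, hjac _ hp]

theorem commonDirectrix_of_planar (hn : n ≠ 0) {f g a b : ℝ → ℝ} {τ1 τ2 τ3 : ℝ × ℝ → ℝ}
    (hJ : IsOpen J) (hJc : IsConnected J) (hmaps : Set.MapsTo lam X.dom13 J)
    (hf : ContDiffOn ℝ n f J) (hg : ContDiffOn ℝ n g J) (hlam : ContDiffOn ℝ n lam X.dom13)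
    (hτ1 : ContDiffOn ℝ n τ1 X.dom23) (hτ2 : ContDiffOn ℝ n τ2 X.dom23)
    (hτ3 : ContDiffOn ℝ n τ3 X.dom23) (hjac23 : ∀ p ∈ X.dom23, jac τ2 τ3 p = a p.2)
    (hjac31 : ∀ p ∈ X.dom23, jac τ3 τ1 p = b p.2)
    (hdir : ∀ p ∈ X.dom13, f (lam p) * a p.2 + g (lam p) * b p.2 = p.1)
    (hpos : ∀ k ∈ X.dom, X.pos k =
      ![f (lam (k.1, k.2.2)) + τ1 k.2, g (lam (k.1, k.2.2)) + τ2 k.2, τ3 k.2]) :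
    CommonDirectrix n X := by
  have hτ := contDiffOn_vec3 hτ1 hτ2 hτ3
  have hcross (p) (hp : p ∈ X.dom23) := crossProduct_partials_eq_jac
    (differentiableAt_of_contDiffOn hn hτ X.isOpen_dom23 hp)
  refine ⟨J, fun s => ![f s, g s, 0], lam, _, _, hJ, hJc, hmaps,
    contDiffOn_vec3 hf hg contDiffOn_const, hlam, hτ, fun i => ?_, fun k hk => ?_,
    fun _ _ => rfl, fun k hk => ?_⟩
  · fin_cases i
    · exact .inr ⟨a, fun p hp => by simp [hcross p hp, hjac23 p hp]⟩
    · exact .inr ⟨b, fun p hp => by simp [hcross p hp, hjac31 p hp]⟩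
    · exact .inl fun s _ => by simp
  · have hp := Flow.mem_dom23 hk
    simpa [hcross _ hp, hjac23 _ hp, hjac31 _ hp, Matrix.vec3_dotProduct] using
      hdir _ (Flow.mem_dom13 hk)
  · simp [hpos k hk]

theorem PlanarFirst.commonDirectrix (hn : n ≠ 0) (h : PlanarFirst n X) :
    CommonDirectrix n X := by
  obtain ⟨K, F, g, τ2, τ3, hK, hmaps, hF, hg, hτ2, hτ3, hjac, hpos⟩ := h
  have hjac31 (p) (hp : p ∈ X.dom23) : jac τ3 (fun q => F (τ3 q)) p = 0 :=
    jac_comp_self (differentiableAt_of_contDiffOn hn hF hK (hmaps hp))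
      (differentiableAt_of_contDiffOn hn hτ3 X.isOpen_dom23 hp)
  exact commonDirectrix_of_planar hn (f := id) (a := fun _ => 1) (b := fun _ => 0)
    X.isOpen_dom1 X.isConnected_dom1 Flow.mapsTo_fst_dom13 contDiffOn_id hg
    contDiff_fst.contDiffOn (hF.comp hτ3 hmaps) hτ2 hτ3 hjac hjac31 (fun _ _ => by simp) hpos

theorem PlanarSecond.commonDirectrix (hn : n ≠ 0) (h : PlanarSecond n X) :
    CommonDirectrix n X := by
  obtain ⟨J, f, g, ν, lam, τ1, τ2, τ3, hJ, hJc, hmaps, hf, hg, hlam, hτ1, hτ2, hτ3, hdir, hjac,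
    hpos⟩ := h
  refine commonDirectrix_of_planar hn (a := fun t => -ν t) (b := fun _ => 1) hJ hJc hmaps hf hg
    hlam hτ1 hτ2 hτ3 (fun p hp => (hjac p hp).2) (fun p hp => ?_) (fun p hp => ?_) hpos
  · rw [jac_swap, (hjac p hp).1, neg_neg]
  · linear_combination hdir p hp

theorem commonDirectrix_of_envelope (hn : n ≠ 0) {u1 u2 S α β γ : ℝ → ℝ} {τ1 τ2 : ℝ × ℝ → ℝ}
    (hJ : IsOpen J) (hJc : IsConnected J) (hmaps : Set.MapsTo lam X.dom13 J)
    (hu1 : ContDiffOn ℝ n u1 J) (hu2 : ContDiffOn ℝ n u2 J) (hS : ContDiffOn ℝ n S J)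
    (hlam : ContDiffOn ℝ n lam X.dom13) (hα : ContDiffOn ℝ n α X.dom3)
    (hβ : ContDiffOn ℝ n β X.dom3) (hγ : ContDiffOn ℝ n γ X.dom3)
    (hτ1 : ContDiffOn ℝ n τ1 X.dom23) (hτ2 : ContDiffOn ℝ n τ2 X.dom23)
    (henv : ∀ p ∈ X.dom23, deriv α p.2 * τ1 p + deriv β p.2 * τ2 p + deriv γ p.2 = 0)
    (hjac : ∀ p ∈ X.dom23, jac τ1 τ2 p = 1)
    (hdir : ∀ p ∈ X.dom13, α p.2 * u1 (lam p) + β p.2 * u2 (lam p) + p.1 = S (lam p))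
    (hpos : ∀ k ∈ X.dom, X.pos k =
      ![u1 (lam (k.1, k.2.2)) + τ1 k.2, u2 (lam (k.1, k.2.2)) + τ2 k.2,
        S (lam (k.1, k.2.2)) + α k.2.2 * τ1 k.2 + β k.2.2 * τ2 k.2 + γ k.2.2]) :
    CommonDirectrix n X := by
  have hτ3 := (((contDiffOn_comp_snd hα).mul hτ1).add ((contDiffOn_comp_snd hβ).mul hτ2)).add
    (contDiffOn_comp_snd hγ)
  refine ⟨J, fun s => ![u1 s, u2 s, S s], lam, _, fun p => ![-α p.2, -β p.2, 1], hJ, hJc, hmaps,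
    contDiffOn_vec3 hu1 hu2 hS, hlam, contDiffOn_vec3 hτ1 hτ2 hτ3,
    fun i => .inr ⟨fun t => ![-α t, -β t, 1] i, fun _ _ => rfl⟩, fun k hk => ?_, fun p hp => ?_,
    fun k hk => ?_⟩
  · simp only [Matrix.vec3_dotProduct', mul_neg, mul_one]
    linear_combination -hdir _ (Flow.mem_dom13 hk)
  · have hasDerivAt_coeff {f : ℝ → ℝ} (hf : ContDiffOn ℝ n f X.dom3) :=
      (differentiableAt_of_contDiffOn hn hf X.isOpen_dom3 (Flow.mapsTo_snd_dom23 hp)).hasDerivAt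
    have hcross := crossProduct_partials_envelope (hasDerivAt_coeff hα) (hasDerivAt_coeff hβ)
      (hasDerivAt_coeff hγ) (differentiableAt_of_contDiffOn hn hτ1 X.isOpen_dom23 hp)
      (differentiableAt_of_contDiffOn hn hτ2 X.isOpen_dom23 hp) (henv p hp)
    rwa [hjac p hp, one_smul] at hcross
  · simp [hpos k hk, add_assoc]

theorem PlanarThird.commonDirectrix (hn : n ≠ 0) (h : PlanarThird n X) :
    CommonDirectrix n X := by
  obtain ⟨u1, u2, τ1, τ2, hu1, hu2, hτ1, hτ2, hjac, hpos⟩ := h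
  exact commonDirectrix_of_envelope hn (S := id) (α := 0) (β := 0) (γ := 0)
    X.isOpen_dom1 X.isConnected_dom1 Flow.mapsTo_fst_dom13 hu1 hu2 contDiffOn_id
    contDiff_fst.contDiffOn contDiffOn_const contDiffOn_const contDiffOn_const hτ1 hτ2
    (fun _ _ => by simp) hjac (fun _ _ => by simp) (fun k hk => by simp [hpos k hk])

theorem Spatial.commonDirectrix (hn : n ≠ 0) (h : Spatial n X) : CommonDirectrix n X := by
  obtain ⟨J, u1, u2, S, lam, α, β, γ, φ, τ1, τ2, hJ, hJc, hmaps, hu1, hu2, hS, -, hlam, hα, hβ,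
    hγ, hφ, hN, hdir, hτφ, hpos⟩ := h
  have hα' := hα.deriv_of_isOpen X.isOpen_dom3 le_rfl
  have hβ' := hβ.deriv_of_isOpen X.isOpen_dom3 le_rfl
  have hγ' := hγ.deriv_of_isOpen X.isOpen_dom3 le_rfl
  -- `(-m, -l)` is the foot of the perpendicular from the origin to `α' x¹ + β' x² + γ' = 0`.
  let N (t : ℝ) : ℝ := deriv α t ^ 2 + deriv β t ^ 2
  let m (t : ℝ) : ℝ := deriv α t * deriv γ t / N t
  let l (t : ℝ) : ℝ := deriv β t * deriv γ t / N t
  have hN' : ContDiffOn ℝ n N X.dom3 := (hα'.pow 2).add (hβ'.pow 2)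
  have hm : ContDiffOn ℝ n m X.dom3 := (hα'.mul hγ').div hN' hN
  have hl : ContDiffOn ℝ n l X.dom3 := (hβ'.mul hγ').div hN' hN
  have hfoot (t) (ht : t ∈ X.dom3) : deriv α t * m t + deriv β t * l t = deriv γ t := by
    have := hN t ht
    simp only [m, l, N]
    field_simp
  have hτ1 : ContDiffOn ℝ n τ1 X.dom23 :=
    (((contDiffOn_comp_snd hβ').mul hφ).sub (contDiffOn_comp_snd hm)).congr fun p hp =>
      (hτφ p hp).1
  have hτ2 : ContDiffOn ℝ n τ2 X.dom23 :=
    (((contDiffOn_comp_snd hα').neg.mul hφ).sub (contDiffOn_comp_snd hl)).congr fun p hp =>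
      (hτφ p hp).2.1
  refine commonDirectrix_of_envelope hn hJ hJc hmaps hu1 hu2 hS hlam (hα.of_le le_self_add)
    (hβ.of_le le_self_add) (hγ.of_le le_self_add) hτ1 hτ2 (fun p hp => ?_) (fun p hp => ?_)
    hdir hpos
  · rw [(hτφ p hp).1, (hτφ p hp).2.1]
    linear_combination -hfoot p.2 (Flow.mapsTo_snd_dom23 hp)
  · refine jac_eq_one_of_quadratic X.isOpen_dom3 X.isOpen_dom23 Flow.mapsTo_snd_dom23
      (hα'.differentiableOn hn) (hβ'.differentiableOn hn) (hγ'.differentiableOn hn)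
      (hm.differentiableOn hn) (hl.differentiableOn hn) (hφ.differentiableOn hn)
      (fun q hq => (hτφ q hq).1) (fun q hq => (hτφ q hq).2.1) hfoot (fun q hq => ?_) hp
    linear_combination (hτφ q hq).2.2

theorem Canonical.commonDirectrix_or_cylindrical (hn : n ≠ 0) (h : Canonical n X) :
    CommonDirectrix n X ∨ Cylindrical n X := by
  rcases h with h | h | h | h | h | h
  · exact .inl (h.commonDirectrix hn)
  · exact .inr h
  all_goals exact .inl (h.commonDirectrix hn)

end ConstPressureMHD

theorem theorem3 (n : WithTop ℕ∞) (hn : 1 ≤ n) :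
    (∀ X : ConstPressureMHD.Flow, ConstPressureMHD.Canonical n X →
      ConstPressureMHD.CommonDirectrix n X ∨ ConstPressureMHD.Cylindrical n X) ∧
    (∀ X : ConstPressureMHD.Flow,
      (∃ Y, ConstPressureMHD.Canonical n Y ∧ ConstPressureMHD.Equivalent n Y X) →
      ∃ Y, ConstPressureMHD.Equivalent n Y X ∧
        (ConstPressureMHD.CommonDirectrix n Y ∨ ConstPressureMHD.Cylindrical n Y)) :=
  have hn0 : n ≠ 0 := (zero_lt_one.trans_le hn).ne'
  ⟨fun _ h => h.commonDirectrix_or_cylindrical hn0,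
    fun _ ⟨Y, hY, hYX⟩ => ⟨Y, hYX, hY.commonDirectrix_or_cylindrical hn0⟩⟩
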